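/- **Setting.** Let $d\ge 1$. A tile is a pair $(A,i)$ with $A\subset\mathbb R^d$ nonempty, compact and equal to the closure of its interior, and $i\in\{1,\dots,\kappa\}$ its type. Let $\omega$ be a primitive tile-substitution with prototiles $T_1,\dots,T_\kappa$ ($T_j=(A_j,j)$), expansive linear map $\phi$ and finite digit sets $\mathcal D_{ij}\subset\mathbb R^d$: $\omega(x+T_j)=\{\phi x+u+T_i: u\in\mathcal D_{ij},\, i\le\kappa\}$, where $\phi A_j=\bigcup_i(\mathcal D_{ij}+A_i)$ with the sets on the right having disjoint interiors. Let $\mathcal T$ be a tiling of $\mathbb R^d$ by translates of prototiles with $\omega(\mathcal T)=\mathcal T$. Let $\gamma$ be a tile map ($\gamma T\in\omega(T)$, with the same relative position for tiles of the same type), let the control point $c(T)$ be given by $\{c(T)\}=\bigcap_{m\ge0}\phi^{-m}(\gamma^mT)$, and put $\mathcal C_i=\{c(T):T\in\mathcal T\text{ of type }i\}$, $\mathcal C=(\mathcal C_i)_{i\le\kappa}$, $\Xi=\bigcup_i(\mathcal C_i-\mathcal C_i)$. As usual, the control points are chosen so that $\langle\bigcup_i\mathcal C_i\rangle=\langle\Xi\rangle$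 (generated subgroups of $\mathbb R^d$). Let $c_i$ be the control point of $T_i$. For a $\kappa$-set $X=(X_i)_{i\le \kappa}$ let $\Phi(X)_i=\bigcup_j\bigcup_{u\in\mathcal D_{ij}}(\phi X_j+u+c_i-\phi c_j)$, so that $\Phi(\mathcal C)=\mathcal C$. Suppose that $\phi$ is diagonalizable over $\mathbb C$, that it is unimodular (its minimal polynomial $p$ over $\mathbb Q$ exists and has constant term $\pm1$), and that its eigenvalues are algebraically conjugate over $\mathbb Q$ and all have the same multiplicity $J$. Fix a basis of $\mathbb R^d$ in which $\phi$ is block diagonal with $J$ equal blocks $\psi$. Here $\psi$ is block diagonal with one block $[\lambda]$ for each real eigenvalue $\lambda$ and one block $\begin{bmatrix}a&-b\\b&a\end{bmatrix}$ for each pair $a\pm ib$ ($b>0$) of nonreal eigenvalues. Let $\alpha_j\in\mathbb R^d$ have all coordinates of the $j$-th block equal to $1$ and all others equal to $0$, and let $L=\mathbb Z[\phi]\alpha_1+\dots+\mathbb Z[\phi]\alpha_J$. Let $D_1=\dots=D_J$ be the block diagonal matrices built in the same way from the roots of $p$ that are not eigenvalues of $\phi$, with $D_j$ acting on a Euclidean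 space $\mathbb G_j$, and let $\beta_j=(1,\dots,1)\in\mathbb G_j$. Put $\mathbb G=\mathbb G_1\times\dots\times\mathbb G_J$, $$\Psi:L\to\mathbb G,\qquad \sum_jP_j(\phi)\alpha_j\mapsto\bigl(P_1(D_1)\beta_1,\dots,P_J(D_J)\beta_J\bigr)\quad(P_j\in\mathbb Z[x]),$$ $\widetilde L=\{(x,\Psi(x)):x\in L\}\subset\mathbb R^d\times\mathbb G$, and $\Lambda(V)=\{x\in L:\Psi(x)\in V\}$ for $V\subset\mathbb G$. **Proposition.** Suppose that $\mathcal T$ is rigid, that is, there is a linear isomorphism $\sigma$ of $\mathbb R^d$ with $\sigma\phi=\phi\sigma$ and $\sigma(\mathcal C_i)\subset L$ for all $i$; suppose moreover that $\sigma$ is such that $L=\langle\sigma(\bigcup_i\mathcal C_i)\rangle$. Suppose that $(\mathbb R^d,\mathbb G,\widetilde L)$ is a cut-and-project scheme: $\widetilde L$ is a lattice (a discrete, cocompact subgroup), its projection to $\mathbb R^d$ is injective, and its projection to $\mathbb G$ has dense image. Suppose finally that for some $N\ge1$ and some $j\le\kappa$ with $0\in\mathcal C_j$, $$\mathcal C=\lim_{n\to\infty}(\Phi^N)^n(\{0\})\quad\text{and}\quad\phi^N\,\Xi\subset\mathcal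 C_j ,$$ where $\{0\}$ stands for the $\kappa$-set with $j$-th component $\{0\}$ and all other components empty. Then for every $i\le\kappa$ there is a nonempty open set $U_i\subset\mathbb G$ with compact closure such that $\sigma(\mathcal C_i)=\Lambda(U_i)$. That is, after identifying $\mathcal C$ with $\sigma(\mathcal C)$, each $\mathcal C_i$ is a Euclidean model set in this cut-and-project scheme with an open, precompact window. -/

import Mathlib

open Polynomial

noncomputable section

namespace SubstTiling

/-- Euclidean space `ℝ^d`. -/
abbrev E (d : ℕ) := EuclideanSpace ℝ (Fin d)

/-! ### Tiles, tilings, tile-substitutions -/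

/-- A tile in `ℝ^d`: a nonempty compact set that is the closure of its interior, with a type. -/
@[ext] structure Tile (d κ : ℕ) where
  supp : Set (E d)
  type : Fin κ
  nonempty : supp.Nonempty
  isCompact : IsCompact supp
  closure_interior : closure (interior supp) = supp

/-- The translate `g + T` of a tile. -/
def Tile.translate {d κ : ℕ} (g : E d) (T : Tile d κ) : Tile d κ where
  supp := (fun y => g + y) '' T.supp
  type := T.type
  nonempty := T.nonempty.image _
  isCompact := T.isCompact.image (by fun_prop)
  closure_interior := by
    have h1 := (Homeomorph.addLeft g).image_interior T.supp
    have h2 := (Homeomorph.addLeft g).image_closure (interior T.supp)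
    simp only [Homeomorph.coe_addLeft] at h1 h2
    rw [← h1, ← h2, T.closure_interior]

/-- A tiling of `ℝ^d`: tiles cover the space, distinct tiles have disjoint interiors, and tiles
of the same type are translates of each other. -/
structure IsTiling {d κ : ℕ} (𝒯 : Set (Tile d κ)) : Prop where
  cover : (⋃ T ∈ 𝒯, T.supp) = Set.univ
  disjoint_interior : ∀ S ∈ 𝒯, ∀ T ∈ 𝒯, S ≠ T → Disjoint (interior S.supp) (interior T.supp)
  same_type : ∀ S ∈ 𝒯, ∀ T ∈ 𝒯, S.type = T.type → ∃ g : E d, T = S.translate g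

/-- A linear map is expansive if it expands all distances by a factor `c > 1` with respect to some
metric that induces the standard topology. -/
def IsExpansive {d : ℕ} (φ : E d →ₗ[ℝ] E d) : Prop :=
  ∃ m : MetricSpace (E d),
    m.toPseudoMetricSpace.toUniformSpace.toTopologicalSpace =
      (inferInstance : TopologicalSpace (E d)) ∧
    ∃ c : ℝ, 1 < c ∧ ∀ x y : E d, c * m.dist x y ≤ m.dist (φ x) (φ y)

/-- A tile-substitution with expansion map `φ`, prototiles `T_j` of type `j` and digit sets
`D_{ij}`, where `ω(T_j) = {u + T_i : u ∈ D_{ij}}`. -/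
structure TileSubstitution (d κ : ℕ) where
  φ : E d →ₗ[ℝ] E d
  expansive : IsExpansive φ
  proto : Fin κ → Tile d κ
  proto_type : ∀ i, (proto i).type = i
  digit : Fin κ → Fin κ → Finset (E d)
  subdivision : ∀ j, φ '' (proto j).supp =
    ⋃ i, ⋃ u ∈ digit i j, ((proto i).translate u).supp
  disjoint_interior : ∀ j i i' u u', u ∈ digit i j → u' ∈ digit i' j → (i, u) ≠ (i', u') →
    Disjoint (interior ((proto i).translate u).supp) (interior ((proto i').translate u').supp)

namespace TileSubstitution

variable {d κ : ℕ} (ω : TileSubstitution d κ)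

/-- The substitution matrix `S(i,j) = # D_{ij}`. -/
def matrix : Matrix (Fin κ) (Fin κ) ℕ := Matrix.of fun i j => (ω.digit i j).card

/-- Some power `S^ℓ`, `ℓ > 0`, has no zero entries. -/
def IsPrimitive : Prop := ∃ l : ℕ, 0 < l ∧ ∀ i j, (ω.matrix ^ l) i j ≠ 0

/-- `ω(x + T_j) = φ x + ω(T_j)` for translates of prototiles. -/
def substTile (T : Tile d κ) : Set (Tile d κ) :=
  {S | ∃ x j, T = (ω.proto j).translate x ∧
    ∃ i, ∃ u ∈ ω.digit i j, S = (ω.proto i).translate (ω.φ x + u)}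

/-- `𝒯` is a tiling by translates of prototiles with `ω(𝒯) = 𝒯`. -/
structure IsFixedTiling (𝒯 : Set (Tile d κ)) : Prop where
  isTiling : IsTiling 𝒯
  translates : ∀ T ∈ 𝒯, ∃ x j, T = (ω.proto j).translate x
  fixed : (⋃ T ∈ 𝒯, ω.substTile T) = 𝒯

/-! ### Control points -/

/-- A tile map: `γ T` is a tile of `ω(T)`, chosen with the same relative position for all tiles
of the same type (the values of `γ` at tiles that are not translates of prototiles are
irrelevant). -/
def IsTileMap (γ : Tile d κ → Tile d κ) : Prop :=
  ∀ j, ∃ i, ∃ u ∈ ω.digit i j, ∀ x,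
    γ ((ω.proto j).translate x) = (ω.proto i).translate (ω.φ x + u)

/-- `c` is the control point of `T`: `{c} = ⋂_m φ^{-m}(γ^m T)`. -/
def IsControlPoint (γ : Tile d κ → Tile d κ) (T : Tile d κ) (c : E d) : Prop :=
  (⋂ m : ℕ, (fun y => (ω.φ ^ m) y) ⁻¹' (γ^[m] T).supp) = {c}

/-- `𝒞_i`: the control points of the tiles of type `i` of the tiling `𝒯`. -/
def controlPoints (γ : Tile d κ → Tile d κ) (𝒯 : Set (Tile d κ)) (i : Fin κ) : Set (E d) :=
  {c | ∃ T ∈ 𝒯, T.type = i ∧ ω.IsControlPoint γ T c}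

/-- The digit sets for control points: since the tile `x + T_i` has control point `x + c_i`, where
`c_i` is the control point of `T_i`, a tile of type `j` with control point `c` produces the tiles
of type `i` with control points `φ c + a`, where `a = u + c_i - φ c_j`, `u ∈ D_{ij}`. If the
prototiles have their control points at the origin, this is `D_{ij}` itself. -/
def controlDigit (γ : Tile d κ → Tile d κ) (i j : Fin κ) : Set (E d) :=
  {a | ∃ u ∈ ω.digit i j, ∃ ci cj, ω.IsControlPoint γ (ω.proto i) ci ∧
    ω.IsControlPoint γ (ω.proto j) cj ∧ a = u + ci - ω.φ cj}

/-- The `κ`-set substitution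
`Φ(X)_i = ⋃_j ⋃_{a} (φ X_j + a)`, `a` in the `(i,j)`-th digit set of the control points. -/
def Phi (γ : Tile d κ → Tile d κ) (X : Fin κ → Set (E d)) : Fin κ → Set (E d) :=
  fun i => ⋃ j, ⋃ a ∈ ω.controlDigit γ i j, (fun x => ω.φ x + a) '' X j

end TileSubstitution

/-- `Ξ = ⋃_i (C_i - C_i)` for a `κ`-set `C`. -/
def returnVectors {d κ : ℕ} (C : Fin κ → Set (E d)) : Set (E d) :=
  ⋃ i, {v | ∃ x ∈ C i, ∃ y ∈ C i, v = x - y}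

/-- The `κ`-set whose `j`-th component is `{0}` and whose other components are empty. -/
def originAt (d : ℕ) {κ : ℕ} (j : Fin κ) : Fin κ → Set (E d) := fun i => {x | i = j ∧ x = 0}

/-- `C = lim_n X n` for `κ`-sets (pointwise convergence of membership). -/
def IsLimit {d κ : ℕ} (X : ℕ → Fin κ → Set (E d)) (C : Fin κ → Set (E d)) : Prop :=
  ∀ i x, ∀ᶠ n in Filter.atTop, (x ∈ X n i ↔ x ∈ C i)

/-! ### Conditions on the expansion map -/

section Eigen

variable {d : ℕ} (φ : E d →ₗ[ℝ] E d)

/-- The minimal polynomial of `φ` over `ℚ` exists and has constant term `±1` (it is `0` in Mathlib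
when `φ` is not algebraic). -/
def IsUnimodular : Prop := (minpoly ℚ φ).coeff 0 = 1 ∨ (minpoly ℚ φ).coeff 0 = -1

/-- `φ` is diagonalizable over `ℂ`. -/
def IsDiagonalizable : Prop :=
  ∃ P : Matrix (Fin d) (Fin d) ℂ, IsUnit P ∧
    (P⁻¹ * (LinearMap.toMatrix (EuclideanSpace.basisFun (Fin d) ℝ).toBasis
      (EuclideanSpace.basisFun (Fin d) ℝ).toBasis φ).map Complex.ofReal * P).IsDiag

/-- The characteristic polynomial of `φ` over `ℂ`. -/
def complexCharpoly : ℂ[X] := φ.charpoly.map Complex.ofRealHom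

/-- The (complex) eigenvalues of `φ` are algebraically conjugate over `ℚ`, and all of them have
multiplicity `J`. -/
def ConjugateEigenvalues (J : ℕ) : Prop :=
  (∀ z w : ℂ, (complexCharpoly φ).IsRoot z → (complexCharpoly φ).IsRoot w → IsConjRoot ℚ z w) ∧
  ∀ z : ℂ, (complexCharpoly φ).IsRoot z → (complexCharpoly φ).rootMultiplicity z = J

/-- The distinct real eigenvalues of `φ`. -/
def realEig : Finset ℝ := φ.charpoly.roots.toFinset

/-- The distinct nonreal eigenvalues of `φ`, one from each pair of complex conjugates. -/
def complexEig : Finset ℂ := {z ∈ (complexCharpoly φ).roots.toFinset | 0 < z.im}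

/-- The real roots of the minimal polynomial of `φ` over `ℚ` that are not eigenvalues of `φ`. -/
def realRest : Finset ℝ := ((minpoly ℚ φ).aroots ℝ).toFinset \ realEig φ

/-- The nonreal roots of the minimal polynomial of `φ` over `ℚ` that are not eigenvalues of `φ`,
one from each pair of complex conjugates. -/
def complexRest : Finset ℂ :=
  {z ∈ ((minpoly ℚ φ).aroots ℂ).toFinset | 0 < z.im} \ complexEig φ

end Eigen

/-! ### Real block-diagonal normal forms -/

/-- Coordinates of `J` copies of a space with one real coordinate for each `r ∈ R` and two real
coordinates for each `z ∈ Z`. -/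
abbrev BlockIndex (R : Finset ℝ) (Z : Finset ℂ) (J : ℕ) : Type := (R ⊕ (Fin 2 × Z)) × Fin J

/-- The block-diagonal matrix with `J` equal blocks, each of them with the diagonal blocks `[r]`
for `r ∈ R` and `[a, -b; b, a]` for `a + ib ∈ Z`. -/
def blockMatrix (R : Finset ℝ) (Z : Finset ℂ) (J : ℕ) :
    Matrix (BlockIndex R Z J) (BlockIndex R Z J) ℝ :=
  Matrix.blockDiagonal fun _ : Fin J =>
    Matrix.fromBlocks (Matrix.diagonal fun r : R => (r : ℝ)) 0 0
      (Matrix.blockDiagonal fun z : Z => !![(z : ℂ).re, -(z : ℂ).im; (z : ℂ).im, (z : ℂ).re])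

/-- The linear map given by `blockMatrix`. -/
def blockMap (R : Finset ℝ) (Z : Finset ℂ) (J : ℕ) :
    EuclideanSpace ℝ (BlockIndex R Z J) →ₗ[ℝ] EuclideanSpace ℝ (BlockIndex R Z J) :=
  Matrix.toEuclideanLin (blockMatrix R Z J)

/-- The vector with all coordinates of the `j`-th copy equal to `1` and all others `0`. -/
def blockOnes (R : Finset ℝ) (Z : Finset ℂ) (J : ℕ) (j : Fin J) :
    EuclideanSpace ℝ (BlockIndex R Z J) :=
  WithLp.toLp 2 fun k => if k.2 = j then 1 else 0

section Scheme

variable {d : ℕ} (φ : E d →ₗ[ℝ] E d) (J : ℕ)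

/-- A change of basis of `ℝ^d` that brings `φ` to its real block-diagonal normal form. -/
structure NormalForm where
  basis : E d ≃ₗ[ℝ] EuclideanSpace ℝ (BlockIndex (realEig φ) (complexEig φ) J)
  conj : ∀ x, basis (φ x) = blockMap (realEig φ) (complexEig φ) J (basis x)

/-- The internal space `𝔾 = 𝔾_1 × ⋯ × 𝔾_J`, `𝔾_j = ℝ^{n-m}`. -/
abbrev Internal := EuclideanSpace ℝ (BlockIndex (realRest φ) (complexRest φ) J)

/-- The map `D` on the internal space. -/
def internalMap : Internal φ J →ₗ[ℝ] Internal φ J := blockMap (realRest φ) (complexRest φ) J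

/-- `β_j` as an element of `𝔾`. -/
def beta (j : Fin J) : Internal φ J := blockOnes (realRest φ) (complexRest φ) J j

variable {φ J}

/-- `α_j ∈ ℝ^d`. -/
def NormalForm.alpha (B : NormalForm φ J) (j : Fin J) : E d :=
  B.basis.symm (blockOnes (realEig φ) (complexEig φ) J j)

/-- `L = ℤ[φ] α_1 + ⋯ + ℤ[φ] α_J`. -/
def NormalForm.L (B : NormalForm φ J) : Set (E d) :=
  {x | ∃ P : Fin J → ℤ[X], x = ∑ j, aeval φ (P j) (B.alpha j)}

/-- The graph `{(x, Ψ x) : x ∈ L}` of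
`Ψ : P_1(φ) α_1 + ⋯ + P_J(φ) α_J ↦ (P_1(D_1) β_1, …, P_J(D_J) β_J)`. -/
def NormalForm.Ltilde (B : NormalForm φ J) : AddSubgroup (E d × Internal φ J) where
  carrier := {p | ∃ P : Fin J → ℤ[X],
    p = (∑ j, aeval φ (P j) (B.alpha j), ∑ j, aeval (internalMap φ J) (P j) (beta φ J j))}
  zero_mem' := ⟨0, by simp; rfl⟩
  add_mem' := by
    rintro _ _ ⟨P, rfl⟩ ⟨Q, rfl⟩
    exact ⟨P + Q, by simp [Finset.sum_add_distrib]⟩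
  neg_mem' := by
    rintro _ ⟨P, rfl⟩
    exact ⟨-P, by simp⟩

end Scheme

/-! ### Cut-and-project schemes and model sets -/

section CPS

variable {d : ℕ} {H : Type*} [AddCommGroup H] [TopologicalSpace H]

/-- `(ℝ^d, H, L̃)` is a cut-and-project scheme: `H` is a locally compact abelian group, `L̃` is a
lattice in `ℝ^d × H`, the first projection is injective on `L̃`, and the image of `L̃` under the
second projection is dense in `H`. -/
structure IsCutAndProject (Lt : AddSubgroup (E d × H)) : Prop where
  topologicalGroup : IsTopologicalAddGroup H
  t2 : T2Space H
  locallyCompact : LocallyCompactSpace H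
  discrete : DiscreteTopology Lt
  cocompact : CompactSpace ((E d × H) ⧸ Lt)
  injOn_fst : Set.InjOn Prod.fst (Lt : Set (E d × H))
  dense_snd : Dense (Prod.snd '' (Lt : Set (E d × H)))

/-- `Λ(V) = {π_1(x) : x ∈ L̃, π_2(x) ∈ V}`. -/
def Lam (Lt : AddSubgroup (E d × H)) (V : Set H) : Set (E d) :=
  {y | ∃ x ∈ Lt, x.2 ∈ V ∧ x.1 = y}

/-- `C = Λ(W)` is a model set with window `W`, a set with nonempty interior and compact
closure. -/
structure IsModelSetWithWindow (Lt : AddSubgroup (E d × H)) (C : Set (E d)) (W : Set H) :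
    Prop where
  nonempty_interior : (interior W).Nonempty
  compact_closure : IsCompact (closure W)
  eq_Lam : C = Lam Lt W

end CPS

/-- `σ` is a linear isomorphism commuting with `φ` and mapping the `κ`-set `C` into `L`: it
witnesses rigidity. -/
structure IsRigidVia {d κ J : ℕ} {φ : E d →ₗ[ℝ] E d} (B : NormalForm φ J)
    (C : Fin κ → Set (E d)) (σ : E d ≃ₗ[ℝ] E d) : Prop where
  comm : ∀ x, σ (φ x) = φ (σ x)
  maps_into : ∀ i, ∀ x ∈ C i, σ x ∈ B.L

end SubstTiling

end

/-!
Write `A = φ ^ N`, let `P` be the union of the sets `C i`, `G` the group generated by `P`, and let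
`ψ` be the star map `Ψ ∘ σ` from `G` to the internal space, on which `ψ ∘ φ = D ∘ ψ`.

*Absorption.* The coincidence `A (C j - C j) ⊆ C j` makes the sets that some power of `A` maps
into `C j` (`Absorbed`) closed under differences. Since `A` also maps every return vector into `C
j`, and return vectors generate `G`, every finite subset of `G`, the set `P`, and all sets `P -
P`, `P - P - P`, … are absorbed; as `C j` is locally finite, so are they. In other words `P` is a
Meyer set.

*Boundedness of `ψ` on `P`.* Choosing a nearest point of `P` for each point of `ℝ^d` and applying
`ψ` gives a map that is additive, and intertwines `φ` with `D`, up to bounded errors. By Hyers'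
theorem (`exists_linearMap_norm_sub_le`) it is close to a linear map `g` with `g ∘ φ = D ∘ g`. As
`φ` and `D` have no common eigenvalue, `g = 0` (`intertwiner_eq_zero`), so `ψ` is bounded on `P`
(`exists_norm_le_of_no_intertwiner`). No contraction property of `D` is needed.

*Openness.* An element `y` of `G` with `‖ψ y‖ ≤ 1` differs from a nearby point of `P` by an
element of `G` that is bounded and has bounded image under `ψ`; by discreteness of the lattice
there are finitely many of these. Hence `{y ∈ G | ‖ψ y‖ ≤ 1}` is absorbed, say by `A ^ k`. If `x ∈
C i`, then by generation from the origin `x` lies in the `i`-th component of `Φ ^ (N n)` of the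
origin for some `n`, whence `x + A ^ n (C j) ⊆ C i` (`Phi_iterate_subset`). Unimodularity gives `s
∈ ℤ[X]` with `φ * s(φ) = 1` (`IsUnimodular.exists_aeval_inverse`). So if `z ∈ G` and `ψ z` is so
close to `ψ x` that `s(D) ^ (N (n + k))` shrinks the difference into the unit ball, then `z - x =
φ ^ (N (n + k)) y` with `y ∈ G` and `‖ψ y‖ ≤ 1`, and `z ∈ C i`. The window of `C i` is the union
of these neighbourhoods of the points `ψ x`, cut down to a ball that contains `ψ '' P`.
-/

namespace SubstTiling

open Filter Topology

/-! ### Expansive maps -/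

lemma IsExpansive.injective {d : ℕ} {φ : E d →ₗ[ℝ] E d} (h : IsExpansive φ) :
    Function.Injective φ := by
  obtain ⟨m, -, c, hc, h⟩ := h
  intro x y hxy
  have h1 := h x y
  rw [hxy, @dist_self _ m.toPseudoMetricSpace] at h1
  have h2 : 0 ≤ m.dist x y := @dist_nonneg _ m.toPseudoMetricSpace x y
  exact @eq_of_dist_eq_zero _ m x y (by nlinarith)

lemma IsExpansive.surjective {d : ℕ} {φ : E d →ₗ[ℝ] E d} (h : IsExpansive φ) :
    Function.Surjective φ :=
  LinearMap.injective_iff_surjective.1 h.injective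

lemma IsExpansive.pow_injective {d : ℕ} {φ : E d →ₗ[ℝ] E d} (h : IsExpansive φ) (n : ℕ) :
    Function.Injective (φ ^ n) := by
  rw [Module.End.coe_pow]
  exact h.injective.iterate n

/-- The metric witnessing expansiveness need not be translation invariant; only distances to the
fixed point `0` are compared, and norm-bounded sets are bounded for that metric by compactness. -/
lemma IsExpansive.eq_zero_of_bounded_orbit {d : ℕ} {φ : E d →ₗ[ℝ] E d} (h : IsExpansive φ)
    {w : E d} {R : ℝ} (hw : ∀ n : ℕ, ‖(φ ^ n) w‖ ≤ R) : w = 0 := by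
  obtain ⟨m, hm, c, hc, h⟩ := h
  have hK : @IsCompact _ m.toPseudoMetricSpace.toUniformSpace.toTopologicalSpace
      (Metric.closedBall (0 : E d) R) := by
    rw [hm]
    exact isCompact_closedBall _ _
  have hb := @IsCompact.isBounded _ m.toPseudoMetricSpace _ hK
  obtain ⟨M, hM⟩ := (@Metric.isBounded_iff _ m.toPseudoMetricSpace _).1 hb
  have hR : 0 ≤ R := (norm_nonneg _).trans (hw 0)
  have key : ∀ n : ℕ, c ^ n * m.dist w 0 ≤ m.dist ((φ ^ n) w) 0 := by
    intro n
    induction n with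
    | zero => simp
    | succ n ih =>
      have h1 := h ((φ ^ n) w) 0
      rw [map_zero] at h1
      rw [pow_succ' φ, Module.End.mul_apply]
      calc c ^ (n + 1) * m.dist w 0 = c * (c ^ n * m.dist w 0) := by ring
        _ ≤ c * m.dist ((φ ^ n) w) 0 := by gcongr
        _ ≤ _ := h1
  have hle : ∀ n : ℕ, c ^ n * m.dist w 0 ≤ M := fun n =>
    (key n).trans (hM (by simpa using hw n) (by simpa using hR))
  have h0 : 0 ≤ m.dist w 0 := @dist_nonneg _ m.toPseudoMetricSpace w 0
  by_contra hne
  have hpos : 0 < m.dist w 0 :=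
    lt_of_le_of_ne h0 fun h => hne (@eq_of_dist_eq_zero _ m w 0 h.symm)
  obtain ⟨n, hn⟩ := pow_unbounded_of_one_lt (M / m.dist w 0) hc
  rw [div_lt_iff₀ hpos] at hn
  exact absurd (hle n) (not_le.2 hn)

/-! ### Control points of substitution tilings -/

lemma Tile.translate_translate {d κ : ℕ} (T : Tile d κ) (g h : E d) :
    (T.translate g).translate h = T.translate (h + g) := by
  ext1
  · simp only [Tile.translate, Set.image_image, add_assoc]
  · rfl

lemma Tile.mem_translate {d κ : ℕ} (T : Tile d κ) (g y : E d) :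
    y ∈ (T.translate g).supp ↔ y - g ∈ T.supp := by
  simp only [Tile.translate, Set.mem_image]
  constructor
  · rintro ⟨z, hz, rfl⟩
    simpa using hz
  · intro h
    exact ⟨_, h, by abel⟩

lemma Tile.translate_zero {d κ : ℕ} (T : Tile d κ) : T.translate 0 = T := by
  ext1
  · simp [Tile.translate]
  · rfl

namespace TileSubstitution

variable {d κ : ℕ} {ω : TileSubstitution d κ} {γ : Tile d κ → Tile d κ}

lemma IsControlPoint.unique {T : Tile d κ} {c c' : E d} (h : ω.IsControlPoint γ T c)
    (h' : ω.IsControlPoint γ T c') : c = c' :=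
  Set.singleton_injective (h.symm.trans h')

lemma IsControlPoint.mem_supp {T : Tile d κ} {c : E d} (h : ω.IsControlPoint γ T c) :
    c ∈ T.supp := by
  have hc : c ∈ ⋂ m : ℕ, (fun y => (ω.φ ^ m) y) ⁻¹' (γ^[m] T).supp := by
    rw [h]; rfl
  simpa using Set.mem_iInter.1 hc 0

lemma IsTileMap.apply_translate (hγ : ω.IsTileMap γ) (j : Fin κ) (x g : E d) :
    γ (((ω.proto j).translate x).translate g) =
      (γ ((ω.proto j).translate x)).translate (ω.φ g) := by
  obtain ⟨i, u, -, h⟩ := hγ j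
  rw [Tile.translate_translate, h, h, Tile.translate_translate, map_add, add_assoc]

lemma IsTileMap.iterate_proto (hγ : ω.IsTileMap γ) (j : Fin κ) (x : E d) (m : ℕ) :
    ∃ i y, γ^[m] ((ω.proto j).translate x) = (ω.proto i).translate y := by
  induction m with
  | zero => exact ⟨j, x, rfl⟩
  | succ m ih =>
    obtain ⟨i, y, h⟩ := ih
    obtain ⟨i', u, -, h'⟩ := hγ i
    exact ⟨i', _, by rw [Function.iterate_succ_apply', h, h']⟩

lemma IsTileMap.iterate_translate (hγ : ω.IsTileMap γ) (j : Fin κ) (x g : E d) (m : ℕ) :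
    γ^[m] (((ω.proto j).translate x).translate g) =
      (γ^[m] ((ω.proto j).translate x)).translate ((ω.φ ^ m) g) := by
  induction m with
  | zero => rfl
  | succ m ih =>
    obtain ⟨i, y, h⟩ := hγ.iterate_proto j x m
    rw [Function.iterate_succ_apply', Function.iterate_succ_apply', ih, h, hγ.apply_translate,
      pow_succ', Module.End.mul_apply]

lemma IsTileMap.supp_subset (hγ : ω.IsTileMap γ) (j : Fin κ) (x : E d) :
    (γ ((ω.proto j).translate x)).supp ⊆ ω.φ '' ((ω.proto j).translate x).supp := by
  obtain ⟨i, u, hu, h⟩ := hγ j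
  rw [h]
  intro y hy
  rw [Tile.mem_translate] at hy
  have h1 : y - ω.φ x ∈ ω.φ '' (ω.proto j).supp := by
    rw [ω.subdivision j]
    refine Set.mem_iUnion.2 ⟨i, Set.mem_iUnion₂.2 ⟨u, hu, ?_⟩⟩
    rw [Tile.mem_translate]
    convert! hy using 1
    abel
  obtain ⟨z, hz, hzy⟩ := h1
  refine ⟨z + x, ?_, ?_⟩
  · rw [Tile.mem_translate]
    simpa using hz
  · rw [map_add, hzy]
    abel

/-- A common bound for the diameters of all translates of prototiles. -/
lemma exists_diam_bound (ω : TileSubstitution d κ) :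
    ∃ R : ℝ, ∀ j x, ∀ y ∈ ((ω.proto j).translate x).supp,
    ∀ z ∈ ((ω.proto j).translate x).supp, ‖y - z‖ ≤ R := by
  have hb : Bornology.IsBounded (⋃ j, (ω.proto j).supp) :=
    Bornology.isBounded_iUnion.2 fun j => (ω.proto j).isCompact.isBounded
  obtain ⟨R, hR⟩ := Metric.isBounded_iff.1 hb
  refine ⟨R, fun j x y hy z hz => ?_⟩
  rw [Tile.mem_translate] at hy hz
  have := hR (Set.mem_iUnion.2 ⟨j, hy⟩) (Set.mem_iUnion.2 ⟨j, hz⟩)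
  rwa [dist_eq_norm, sub_sub_sub_cancel_right] at this

/-- The sets `φ⁻ᵐ (γᵐ T)` form a decreasing sequence of nonempty compact sets, and two points in all
of them have a difference with bounded orbit under the expansive map `φ`. -/
lemma IsTileMap.exists_isControlPoint (hγ : ω.IsTileMap γ) (j : Fin κ) (x : E d) :
    ∃ c, ω.IsControlPoint γ ((ω.proto j).translate x) c := by
  set T := (ω.proto j).translate x with hT
  let K : ℕ → Set (E d) := fun m => (fun y => (ω.φ ^ m) y) ⁻¹' (γ^[m] T).supp
  have hcont : ∀ m, Continuous fun y => (ω.φ ^ m) y := fun m =>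
    LinearMap.continuous_of_finiteDimensional (ω.φ ^ m)
  have hne : (⋂ m, K m).Nonempty := by
    refine IsCompact.nonempty_iInter_of_sequence_nonempty_isCompact_isClosed K ?_ ?_ ?_ ?_
    · intro m y hy
      obtain ⟨i, z, hz⟩ := hγ.iterate_proto j x m
      simp only [K, Set.mem_preimage, Function.iterate_succ_apply'] at hy ⊢
      rw [hT, hz] at hy ⊢
      obtain ⟨w, hw, hwy⟩ := hγ.supp_subset i z hy
      rw [pow_succ', Module.End.mul_apply] at hwy
      rwa [← ω.expansive.injective hwy]
    · intro m
      obtain ⟨y, hy⟩ := (γ^[m] T).nonempty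
      have hs : Function.Surjective (ω.φ ^ m) := by
        rw [Module.End.coe_pow]
        exact ω.expansive.surjective.iterate m
      obtain ⟨z, rfl⟩ := hs y
      exact ⟨z, hy⟩
    · simpa [K] using T.isCompact
    · exact fun m => (γ^[m] T).isCompact.isClosed.preimage (hcont m)
  obtain ⟨c, hc⟩ := hne
  refine ⟨c, Set.eq_singleton_iff_unique_mem.2 ⟨hc, fun y hy => ?_⟩⟩
  obtain ⟨R, hR⟩ := ω.exists_diam_bound
  refine sub_eq_zero.1 (ω.expansive.eq_zero_of_bounded_orbit (R := R) fun n => ?_)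
  obtain ⟨i, z, hz⟩ := hγ.iterate_proto j x n
  have h1 := Set.mem_iInter.1 hy n
  have h2 := Set.mem_iInter.1 hc n
  simp only [K, Set.mem_preimage] at h1 h2
  rw [hT, hz] at h1 h2
  rw [map_sub]
  exact hR _ _ _ h1 _ h2

lemma IsControlPoint.translate (hγ : ω.IsTileMap γ) {j : Fin κ} {x c : E d}
    (h : ω.IsControlPoint γ ((ω.proto j).translate x) c) (g : E d) :
    ω.IsControlPoint γ (((ω.proto j).translate x).translate g) (c + g) := by
  have key : ∀ y, y ∈ (⋂ m : ℕ, (fun y => (ω.φ ^ m) y) ⁻¹'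
        (γ^[m] (((ω.proto j).translate x).translate g)).supp) ↔
      y - g ∈ (⋂ m : ℕ, (fun y => (ω.φ ^ m) y) ⁻¹' (γ^[m] ((ω.proto j).translate x)).supp) := by
    intro y
    simp only [Set.mem_iInter, Set.mem_preimage, hγ.iterate_translate, Tile.mem_translate, map_sub]
  ext y
  rw [key, h, Set.mem_singleton_iff, Set.mem_singleton_iff, sub_eq_iff_eq_add]

lemma IsControlPoint.translate_proto (hγ : ω.IsTileMap γ) {j : Fin κ} {c : E d}
    (h : ω.IsControlPoint γ (ω.proto j) c) (g : E d) :
    ω.IsControlPoint γ ((ω.proto j).translate g) (c + g) := by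
  have := IsControlPoint.translate hγ (x := 0) (by rwa [Tile.translate_zero]) g
  rwa [Tile.translate_zero] at this

/-- The control point of `γ T` is the image under `φ` of the control point of `T`. -/
lemma IsControlPoint.image (hγ : ω.IsTileMap γ) {j : Fin κ} {x c : E d}
    (h : ω.IsControlPoint γ ((ω.proto j).translate x) c) :
    ω.IsControlPoint γ (γ ((ω.proto j).translate x)) (ω.φ c) := by
  obtain ⟨i, y, hy⟩ := hγ.iterate_proto j x 1
  rw [Function.iterate_one] at hy
  obtain ⟨c', hc'⟩ := hγ.exists_isControlPoint i y
  rw [← hy] at hc'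
  have hmem : ω.φ c ∈ ⋂ m : ℕ, (fun y => (ω.φ ^ m) y) ⁻¹'
      (γ^[m] (γ ((ω.proto j).translate x))).supp := by
    refine Set.mem_iInter.2 fun m => ?_
    have hc : c ∈ ⋂ m : ℕ, (fun y => (ω.φ ^ m) y) ⁻¹' (γ^[m] ((ω.proto j).translate x)).supp := by
      rw [h]; rfl
    have := Set.mem_iInter.1 hc (m + 1)
    rwa [Set.mem_preimage, Function.iterate_succ_apply, pow_succ, Module.End.mul_apply] at this
  rw [hc', Set.mem_singleton_iff] at hmem
  rwa [hmem]

variable {𝒯 : Set (Tile d κ)}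

lemma mem_controlPoints_iff (hγ : ω.IsTileMap γ) (h𝒯 : ω.IsFixedTiling 𝒯) {i : Fin κ}
    {ci : E d} (hci : ω.IsControlPoint γ (ω.proto i) ci) (c : E d) :
    c ∈ ω.controlPoints γ 𝒯 i ↔ (ω.proto i).translate (c - ci) ∈ 𝒯 := by
  constructor
  · rintro ⟨T, hT, hi, hc⟩
    obtain ⟨x, j, rfl⟩ := h𝒯.translates T hT
    obtain rfl : j = i := (ω.proto_type j).symm.trans hi
    have := hc.unique (hci.translate_proto hγ x)
    rwa [this, add_sub_cancel_left]
  · intro h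
    refine ⟨_, h, ω.proto_type i, ?_⟩
    simpa using hci.translate_proto hγ (c - ci)

lemma controlPoints_relativelyDense (hγ : ω.IsTileMap γ) (h𝒯 : ω.IsFixedTiling 𝒯) :
    ∃ R : ℝ, ∀ v, ∃ c ∈ ⋃ i, ω.controlPoints γ 𝒯 i, ‖v - c‖ ≤ R := by
  obtain ⟨R, hR⟩ := ω.exists_diam_bound
  refine ⟨R, fun v => ?_⟩
  have hv : v ∈ ⋃ T ∈ 𝒯, T.supp := h𝒯.isTiling.cover ▸ Set.mem_univ v
  obtain ⟨T, hT, hvT⟩ := Set.mem_iUnion₂.1 hv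
  obtain ⟨x, j, rfl⟩ := h𝒯.translates T hT
  obtain ⟨c, hc⟩ := hγ.exists_isControlPoint j x
  exact ⟨c, Set.mem_iUnion.2 ⟨j, _, hT, ω.proto_type j, hc⟩, hR _ _ _ hvT _ hc.mem_supp⟩

lemma substTile_subset (h𝒯 : ω.IsFixedTiling 𝒯) {T : Tile d κ} (hT : T ∈ 𝒯) :
    ω.substTile T ⊆ 𝒯 := fun S hS => by
  rw [← h𝒯.fixed]
  exact Set.mem_iUnion₂.2 ⟨T, hT, hS⟩

lemma map_mem_controlPoints (hγ : ω.IsTileMap γ) (h𝒯 : ω.IsFixedTiling 𝒯) {c : E d}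
    (hc : c ∈ ⋃ i, ω.controlPoints γ 𝒯 i) : ω.φ c ∈ ⋃ i, ω.controlPoints γ 𝒯 i := by
  obtain ⟨i, T, hT, -, hc⟩ := Set.mem_iUnion.1 hc
  obtain ⟨x, j, rfl⟩ := h𝒯.translates T hT
  obtain ⟨i', u, hu, h⟩ := hγ j
  refine Set.mem_iUnion.2 ⟨i', _, substTile_subset h𝒯 hT ?_, ?_, hc.image hγ⟩
  · exact ⟨x, j, rfl, i', u, hu, h x⟩
  · rw [h]
    exact ω.proto_type i'

lemma Phi_controlPoints_subset (hγ : ω.IsTileMap γ) (h𝒯 : ω.IsFixedTiling 𝒯) (i : Fin κ) :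
    ω.Phi γ (ω.controlPoints γ 𝒯) i ⊆ ω.controlPoints γ 𝒯 i := by
  intro y hy
  obtain ⟨j, hy⟩ := Set.mem_iUnion.1 hy
  obtain ⟨a, ⟨u, hu, ci, cj, hci, hcj, rfl⟩, x, hx, rfl⟩ := Set.mem_iUnion₂.1 hy
  rw [mem_controlPoints_iff hγ h𝒯 hcj] at hx
  rw [mem_controlPoints_iff hγ h𝒯 hci]
  refine substTile_subset h𝒯 hx ⟨_, j, rfl, i, u, hu, ?_⟩
  have h : ω.φ (x - cj) + u = ω.φ x + (u + ci - ω.φ cj) - ci := by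
    rw [map_sub]
    abel
  rw [h]

/-- A point that `n` steps of the substitution produce from the origin of type `j` is produced by
the same steps from every other control point of type `j`, with the appropriate shift. -/
lemma Phi_iterate_subset (hγ : ω.IsTileMap γ) (h𝒯 : ω.IsFixedTiling 𝒯) (j : Fin κ) (n : ℕ) :
    ∀ i, ∀ x ∈ (ω.Phi γ)^[n] (originAt d j) i, ∀ y ∈ ω.controlPoints γ 𝒯 j,
      (ω.φ ^ n) y + x ∈ ω.controlPoints γ 𝒯 i := by
  induction n with
  | zero =>
    rintro i x ⟨rfl, rfl⟩ y hy
    simpa using hy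
  | succ n ih =>
    intro i x hx y hy
    rw [Function.iterate_succ_apply'] at hx
    obtain ⟨i', hx⟩ := Set.mem_iUnion.1 hx
    obtain ⟨a, ha, x', hx', rfl⟩ := Set.mem_iUnion₂.1 hx
    refine Phi_controlPoints_subset hγ h𝒯 i (Set.mem_iUnion.2 ⟨i', Set.mem_iUnion₂.2
      ⟨a, ha, _, ih i' x' hx' y hy, ?_⟩⟩)
    simp only [map_add, pow_succ', Module.End.mul_apply, add_assoc]

/-- Two tiles of type `i` of the tiling contain translates of the same ball in their disjoint
interiors, so their control points are separated. -/
lemma controlPoints_separated (hγ : ω.IsTileMap γ) (h𝒯 : ω.IsFixedTiling 𝒯) (i : Fin κ) :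
    ∃ r : ℝ, 0 < r ∧ ∀ c ∈ ω.controlPoints γ 𝒯 i, ∀ c' ∈ ω.controlPoints γ 𝒯 i, c ≠ c' →
      r ≤ dist c c' := by
  obtain ⟨ci, hci⟩ := hγ.exists_isControlPoint i 0
  rw [Tile.translate_zero] at hci
  have hne : (interior (ω.proto i).supp).Nonempty := by
    rw [← closure_nonempty_iff, (ω.proto i).closure_interior]
    exact (ω.proto i).nonempty
  obtain ⟨p, hp⟩ := hne
  obtain ⟨r, hr, hball⟩ := Metric.mem_nhds_iff.1 (mem_interior_iff_mem_nhds.1 hp)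
  have hint : ∀ x, Metric.ball (p + x) r ⊆ interior ((ω.proto i).translate x).supp := by
    intro x
    refine interior_maximal (fun y hy => ?_) Metric.isOpen_ball
    rw [Tile.mem_translate]
    apply hball
    rw [Metric.mem_ball, dist_eq_norm] at hy ⊢
    convert! hy using 2
    abel
  refine ⟨r, hr, fun c hc c' hc' hcc' => ?_⟩
  by_contra hlt
  rw [mem_controlPoints_iff hγ h𝒯 hci] at hc hc'
  have hneT : (ω.proto i).translate (c - ci) ≠ (ω.proto i).translate (c' - ci) := by
    intro h
    have h1 := hci.translate_proto hγ (c - ci)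
    have h2 := hci.translate_proto hγ (c' - ci)
    rw [h] at h1
    exact hcc' (by simpa using h1.unique h2)
  refine Set.disjoint_left.1 (h𝒯.isTiling.disjoint_interior _ hc _ hc' hneT)
    (hint _ (Metric.mem_ball_self hr)) (hint _ ?_)
  rw [Metric.mem_ball, dist_add_left, dist_sub_right]
  exact not_le.1 hlt

lemma controlPoints_locallyFinite (hγ : ω.IsTileMap γ) (h𝒯 : ω.IsFixedTiling 𝒯) (i : Fin κ)
    (R : ℝ) : (ω.controlPoints γ 𝒯 i ∩ Metric.closedBall 0 R).Finite := by
  obtain ⟨r, hr, hsep⟩ := controlPoints_separated hγ h𝒯 i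
  obtain ⟨t, ht, hcov⟩ := Metric.totallyBounded_iff.1
    (isCompact_closedBall (0 : E d) R).totallyBounded (r / 2) (half_pos hr)
  have hfin : (⋃ p ∈ t, ω.controlPoints γ 𝒯 i ∩ Metric.ball p (r / 2)).Finite := by
    refine ht.biUnion fun p _ => Set.Subsingleton.finite ?_
    rintro c ⟨hc, hcp⟩ c' ⟨hc', hcp'⟩
    by_contra hne
    have h1 := hsep c hc c' hc' hne
    have h2 := dist_triangle_right c c' p
    rw [Metric.mem_ball] at hcp hcp'
    linarith
  refine hfin.subset fun c hc => ?_
  obtain ⟨p, hp, hcp⟩ := Set.mem_iUnion₂.1 (hcov hc.2)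
  exact Set.mem_iUnion₂.2 ⟨p, hp, hc.1, hcp⟩

lemma controlPoints_nonempty_of_matrix_pow (hγ : ω.IsTileMap γ) (h𝒯 : ω.IsFixedTiling 𝒯)
    {j : Fin κ} (hj : (ω.controlPoints γ 𝒯 j).Nonempty) (l : ℕ) :
    ∀ i, (ω.matrix ^ l) i j ≠ 0 → (ω.controlPoints γ 𝒯 i).Nonempty := by
  induction l with
  | zero =>
    intro i hi
    rw [pow_zero, Matrix.one_apply, ne_eq, ite_eq_right_iff, not_forall] at hi
    obtain ⟨rfl, -⟩ := hi
    exact hj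
  | succ l ih =>
    intro i hi
    rw [pow_succ', Matrix.mul_apply] at hi
    obtain ⟨k, -, hk⟩ := Finset.exists_ne_zero_of_sum_ne_zero hi
    obtain ⟨hik, hkj⟩ := mul_ne_zero_iff.1 hk
    obtain ⟨_, T, hT, htype, -⟩ := ih k hkj
    obtain ⟨x, k', rfl⟩ := h𝒯.translates T hT
    obtain rfl : k' = k := (ω.proto_type k').symm.trans htype
    obtain ⟨u, hu⟩ := Finset.card_ne_zero.1 hik
    obtain ⟨c, hc⟩ := hγ.exists_isControlPoint i (ω.φ x + u)
    exact ⟨c, _, substTile_subset h𝒯 hT ⟨x, k', rfl, i, u, hu, rfl⟩, ω.proto_type i, hc⟩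

end TileSubstitution

/-! ### Quasi-additive maps -/

section QuasiAdditive

variable {V W : Type*} [NormedAddCommGroup V] [NormedSpace ℝ V] [NormedAddCommGroup W]
  [NormedSpace ℝ W]

lemma _root_.LinearMap.eq_zero_of_norm_le (f : V →ₗ[ℝ] W) {K : ℝ} (h : ∀ v, ‖f v‖ ≤ K) :
    f = 0 := by
  ext v
  by_contra hne
  have hpos : 0 < ‖f v‖ := norm_pos_iff.2 hne
  obtain ⟨n, hn⟩ := exists_nat_gt (K / ‖f v‖)
  rw [div_lt_iff₀ hpos] at hn
  have := h ((n : ℝ) • v)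
  rw [map_smul, norm_smul, Real.norm_natCast] at this
  linarith

/-- Hyers' theorem: a map that is additive up to a bounded error, and bounded on the unit ball, is
at bounded distance from a linear map, namely `v ↦ lim 2⁻ⁿ f (2ⁿ v)`. -/
theorem exists_linearMap_norm_sub_le [CompleteSpace W] {f : V → W} {K M : ℝ}
    (hK : ∀ v w, ‖f (v + w) - f v - f w‖ ≤ K) (hM : ∀ v, ‖v‖ ≤ 1 → ‖f v‖ ≤ M) :
    ∃ g : V →ₗ[ℝ] W, ∀ v, ‖f v - g v‖ ≤ K := by
  -- consecutive terms of `2⁻ⁿ f (2ⁿ v)` differ by at most `2⁻ⁿ⁻¹ K`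
  let F : V → ℕ → W := fun v n => ((2 : ℝ) ^ n)⁻¹ • f ((2 : ℝ) ^ n • v)
  have hF : ∀ v n, dist (F v n) (F v (n + 1)) ≤ K / 2 / 2 ^ n := by
    intro v n
    have h2 : (2 : ℝ) ^ (n + 1) • v = (2 : ℝ) ^ n • v + (2 : ℝ) ^ n • v := by
      rw [← two_smul ℝ ((2 : ℝ) ^ n • v), smul_smul, pow_succ']
    have h3 : F v n - F v (n + 1) = -(((2 : ℝ) ^ (n + 1))⁻¹ •
        (f ((2 : ℝ) ^ n • v + (2 : ℝ) ^ n • v) - f ((2 : ℝ) ^ n • v) - f ((2 : ℝ) ^ n • v))) := by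
      simp only [F, h2]
      have h4 : ((2 : ℝ) ^ n)⁻¹ = ((2 : ℝ) ^ (n + 1))⁻¹ * 2 := by
        field_simp
        ring
      rw [h4]
      module
    rw [dist_eq_norm, h3, norm_neg, norm_smul, Real.norm_of_nonneg (by positivity)]
    calc ((2 : ℝ) ^ (n + 1))⁻¹ * _ ≤ ((2 : ℝ) ^ (n + 1))⁻¹ * K := by gcongr; exact hK _ _
      _ = K / 2 / 2 ^ n := by field_simp; ring
  have hlim : ∀ v, ∃ w, Tendsto (F v) atTop (𝓝 w) := fun v =>
    cauchySeq_tendsto_of_complete (cauchySeq_of_le_geometric_two (hF v))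
  choose g hg using hlim
  have hfg : ∀ v, ‖f v - g v‖ ≤ K := by
    intro v
    have := dist_le_of_le_geometric_two_of_tendsto₀ (hF v) (hg v)
    simpa [F, dist_eq_norm] using this
  have hadd : ∀ v w, g (v + w) = g v + g w := by
    intro v w
    have h1 : Tendsto (fun n => F (v + w) n - F v n - F w n) atTop (𝓝 (g (v + w) - g v - g w)) :=
      ((hg _).sub (hg _)).sub (hg _)
    have h2 : Tendsto (fun n => F (v + w) n - F v n - F w n) atTop (𝓝 0) := by
      have h3 : Tendsto (fun n : ℕ => ((2 : ℝ) ^ n)⁻¹ * K) atTop (𝓝 0) := by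
        simpa [inv_pow] using (tendsto_pow_atTop_nhds_zero_of_lt_one (r := (2 : ℝ)⁻¹)
          (by norm_num) (by norm_num)).mul_const K
      refine squeeze_zero_norm (fun n => ?_) h3
      simp only [F]
      rw [← smul_sub, ← smul_sub, norm_smul, Real.norm_of_nonneg (by positivity), smul_add]
      gcongr
      exact hK _ _
    have h4 := tendsto_nhds_unique h1 h2
    rw [sub_sub, sub_eq_zero] at h4
    exact h4
  let G : V →+ W := AddMonoidHom.mk' g hadd
  have hG : Continuous G := by
    refine G.continuous_of_isBounded_nhds_zero (Metric.closedBall_mem_nhds 0 one_pos) ?_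
    refine isBounded_iff_forall_norm_le.2 ⟨M + K, ?_⟩
    rintro _ ⟨v, hv, rfl⟩
    have h1 := hM v (by simpa using hv)
    have h2 := norm_sub_norm_le (g v) (f v)
    rw [norm_sub_rev] at h2
    have h3 : ‖G v‖ = ‖g v‖ := rfl
    linarith [hfg v]
  exact ⟨(G.toRealLinearMap hG : V →ₗ[ℝ] W), hfg⟩

end QuasiAdditive

/-! ### Sets absorbed by a power of an expansion -/

section Absorbed

variable {V W : Type*} [NormedAddCommGroup V] [NormedSpace ℝ V] [NormedAddCommGroup W]
  [NormedSpace ℝ W]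

/-- The set `S` is absorbed by `X` under `A` if some power of `A` maps `S` into `X`. The lemmas
below assume `A (X - X) ⊆ X` and `0 ∈ X`; then all higher powers of `A` also map `S` into `X`. -/
def Absorbed (A : V →ₗ[ℝ] V) (X S : Set V) : Prop := ∃ k : ℕ, ∀ a ∈ S, (A ^ k) a ∈ X

variable {A : V →ₗ[ℝ] V} {X S T : Set V}

lemma Absorbed.mono (hT : Absorbed A X T) (h : S ⊆ T) : Absorbed A X S :=
  let ⟨k, hk⟩ := hT
  ⟨k, fun a ha => hk a (h ha)⟩

lemma pow_mem_of_le (h0 : 0 ∈ X) (hA : ∀ x ∈ X, ∀ y ∈ X, A (x - y) ∈ X) {k l : ℕ} (hkl : k ≤ l)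
    {x : V} (hx : (A ^ k) x ∈ X) : (A ^ l) x ∈ X := by
  induction l, hkl using Nat.le_induction with
  | base => exact hx
  | succ l _ ih =>
    have := hA _ ih _ h0
    rwa [sub_zero, ← Module.End.mul_apply, ← pow_succ'] at this

lemma Absorbed.exists_common (h0 : 0 ∈ X) (hA : ∀ x ∈ X, ∀ y ∈ X, A (x - y) ∈ X)
    (hS : Absorbed A X S) (hT : Absorbed A X T) :
    ∃ k : ℕ, (∀ a ∈ S, (A ^ k) a ∈ X) ∧ ∀ a ∈ T, (A ^ k) a ∈ X :=
  let ⟨k, hk⟩ := hS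
  let ⟨l, hl⟩ := hT
  ⟨max k l, fun a ha => pow_mem_of_le h0 hA (le_max_left k l) (hk a ha),
    fun a ha => pow_mem_of_le h0 hA (le_max_right k l) (hl a ha)⟩

lemma Absorbed.sub (h0 : 0 ∈ X) (hA : ∀ x ∈ X, ∀ y ∈ X, A (x - y) ∈ X)
    (hS : Absorbed A X S) (hT : Absorbed A X T) :
    Absorbed A X {v | ∃ s ∈ S, ∃ t ∈ T, v = s - t} := by
  obtain ⟨k, hS, hT⟩ := hS.exists_common h0 hA hT
  refine ⟨k + 1, ?_⟩
  rintro _ ⟨s, hs, t, ht, rfl⟩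
  have := hA _ (hS s hs) _ (hT t ht)
  rwa [← map_sub, ← Module.End.mul_apply, ← pow_succ'] at this

lemma absorbed_zero (h0 : 0 ∈ X) : Absorbed A X {0} :=
  ⟨0, by rintro _ rfl; simpa using h0⟩

lemma Absorbed.add (h0 : 0 ∈ X) (hA : ∀ x ∈ X, ∀ y ∈ X, A (x - y) ∈ X)
    (hS : Absorbed A X S) (hT : Absorbed A X T) :
    Absorbed A X {v | ∃ s ∈ S, ∃ t ∈ T, v = s + t} := by
  refine (hS.sub h0 hA ((absorbed_zero h0).sub h0 hA hT)).mono ?_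
  rintro _ ⟨s, hs, t, ht, rfl⟩
  exact ⟨s, hs, 0 - t, ⟨0, rfl, t, ht, rfl⟩, by abel⟩

lemma absorbed_iUnion {ι : Type*} [Finite ι] (h0 : 0 ∈ X)
    (hA : ∀ x ∈ X, ∀ y ∈ X, A (x - y) ∈ X) {S : ι → Set V} (hS : ∀ i, Absorbed A X (S i)) :
    Absorbed A X (⋃ i, S i) := by
  choose k hk using hS
  obtain ⟨l, hl⟩ := (Set.finite_range k).bddAbove
  refine ⟨l, fun a ha => ?_⟩
  obtain ⟨i, hi⟩ := Set.mem_iUnion.1 ha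
  exact pow_mem_of_le h0 hA (hl ⟨i, rfl⟩) (hk i a hi)

/-- Pointwise absorption passes to the generated subgroup; the power of `A` depends on the point. -/
lemma absorbed_singleton_of_mem_closure (h0 : 0 ∈ X) (hA : ∀ x ∈ X, ∀ y ∈ X, A (x - y) ∈ X)
    (hS : ∀ x ∈ S, Absorbed A X {x}) {x : V} (hx : x ∈ AddSubgroup.closure S) :
    Absorbed A X {x} := by
  induction hx using AddSubgroup.closure_induction with
  | mem x hx => exact hS x hx
  | zero => exact absorbed_zero h0
  | add x y _ _ hx hy =>
    refine (hx.add h0 hA hy).mono ?_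
    rintro _ rfl
    exact ⟨x, rfl, y, rfl, rfl⟩
  | neg x _ hx =>
    refine ((absorbed_zero h0).sub h0 hA hx).mono ?_
    rintro _ rfl
    exact ⟨0, rfl, x, rfl, by simp⟩

lemma absorbed_of_finite (h0 : 0 ∈ X) (hA : ∀ x ∈ X, ∀ y ∈ X, A (x - y) ∈ X)
    (hfin : S.Finite) (hS : ∀ x ∈ S, Absorbed A X {x}) : Absorbed A X S := by
  have := hfin.to_subtype
  refine (absorbed_iUnion h0 hA fun x : S => hS x x.2).mono fun x hx => ?_
  exact Set.mem_iUnion.2 ⟨⟨x, hx⟩, rfl⟩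

lemma Absorbed.locallyFinite [FiniteDimensional ℝ V] (hinj : Function.Injective A)
    (hX : ∀ R : ℝ, (X ∩ Metric.closedBall 0 R).Finite) (hS : Absorbed A X S) (R : ℝ) :
    (S ∩ Metric.closedBall 0 R).Finite := by
  obtain ⟨k, hk⟩ := hS
  have hinj' : Function.Injective (A ^ k) := by
    rw [Module.End.coe_pow]
    exact hinj.iterate k
  refine ((hX (‖LinearMap.toContinuousLinearMap (A ^ k)‖ * R)).preimage hinj'.injOn).subset ?_
  rintro x ⟨hx, hxR⟩
  rw [mem_closedBall_zero_iff] at hxR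
  refine ⟨hk x hx, ?_⟩
  rw [mem_closedBall_zero_iff]
  exact ((LinearMap.toContinuousLinearMap (A ^ k)).le_opNorm x).trans (by gcongr)

/-- Let `P` be a relatively dense set with `φ P ⊆ P` whose finite difference sets are locally
finite, and let `ψ` be additive on the group generated by `P` and intertwine `φ` with `D`. The
composite of `ψ` with a choice of nearest points of `P` is quasi-additive, hence close to a linear
map `g` with `g φ = D g`. If only `g = 0` has this property, then `ψ` is bounded on `P`. -/
theorem exists_norm_le_of_no_intertwiner [FiniteDimensional ℝ V] [FiniteDimensional ℝ W]
    (h0 : 0 ∈ X) (hA : ∀ x ∈ X, ∀ y ∈ X, A (x - y) ∈ X) (hinj : Function.Injective A)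
    (hX : ∀ R : ℝ, (X ∩ Metric.closedBall 0 R).Finite)
    {P : Set V} (hP : Absorbed A X P) {R : ℝ} (hR : ∀ v, ∃ c ∈ P, ‖v - c‖ ≤ R)
    {φ : V →ₗ[ℝ] V} (hφ : ∀ c ∈ P, φ c ∈ P) {ψ : V → W} {G : AddSubgroup V} (hPG : P ⊆ G)
    (hψ : ∀ x ∈ G, ∀ y ∈ G, ψ (x - y) = ψ x - ψ y) {D : W →ₗ[ℝ] W}
    (hD : ∀ x ∈ G, ψ (φ x) = D (ψ x))
    (hg : ∀ g : V →ₗ[ℝ] W, (∀ v, g (φ v) = D (g v)) → g = 0) :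
    ∃ K : ℝ, ∀ c ∈ P, ‖ψ c‖ ≤ K := by
  have hbd : ∀ S, Absorbed A X S → ∀ r : ℝ, ∃ K : ℝ, ∀ x ∈ S, ‖x‖ ≤ r → ‖ψ x‖ ≤ K := by
    intro S hS r
    obtain ⟨K, hK⟩ := ((hS.locallyFinite hinj hX r).image fun x => ‖ψ x‖).bddAbove
    exact ⟨K, fun x hx hxr => hK ⟨x, ⟨hx, by simpa using hxr⟩, rfl⟩⟩
  have hPP := hP.sub h0 hA hP
  choose q hqP hqR using hR
  have hqG : ∀ v, q v ∈ G := fun v => hPG (hqP v)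
  obtain ⟨K, hK⟩ := hbd _ (hPP.sub h0 hA hP) (R + R + R)
  obtain ⟨M, hM⟩ := hbd _ hP (1 + R)
  let φ' := LinearMap.toContinuousLinearMap φ
  let D' := LinearMap.toContinuousLinearMap D
  obtain ⟨K', hK'⟩ := hbd _ hPP (R + ‖φ'‖ * R)
  obtain ⟨K'', hK''⟩ := hbd _ hPP R
  have hadd : ∀ v w, ‖ψ (q (v + w)) - ψ (q v) - ψ (q w)‖ ≤ K := by
    intro v w
    rw [← hψ _ (hqG _) _ (hqG _), ← hψ _ (G.sub_mem (hqG _) (hqG _)) _ (hqG _)]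
    refine hK _ ⟨_, ⟨_, hqP _, _, hqP _, rfl⟩, _, hqP _, rfl⟩ ?_
    calc ‖q (v + w) - q v - q w‖ = ‖(v - q v) + (w - q w) - (v + w - q (v + w))‖ := by
          congr 1; abel
      _ ≤ ‖v - q v‖ + ‖w - q w‖ + ‖v + w - q (v + w)‖ :=
          (norm_sub_le _ _).trans (add_le_add_left (norm_add_le _ _) _)
      _ ≤ R + R + R := by gcongr <;> exact hqR _
  have hball : ∀ v, ‖v‖ ≤ 1 → ‖ψ (q v)‖ ≤ M := by
    intro v hv
    refine hM _ (hqP v) ?_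
    calc ‖q v‖ = ‖v - (v - q v)‖ := by congr 1; abel
      _ ≤ ‖v‖ + ‖v - q v‖ := norm_sub_le _ _
      _ ≤ 1 + R := by gcongr; exact hqR _
  obtain ⟨g, hfg⟩ := exists_linearMap_norm_sub_le (f := fun v => ψ (q v)) hadd hball
  have hgφ : ∀ v, g (φ v) = D (g v) := by
    have hz : g.comp φ - D.comp g = 0 := by
      refine LinearMap.eq_zero_of_norm_le _ (K := K + K' + ‖D'‖ * K) fun v => ?_
      have h1 : ‖ψ (q (φ v)) - D (ψ (q v))‖ ≤ K' := by
        rw [← hD _ (hqG v), ← hψ _ (hqG _) _ (hPG (hφ _ (hqP v)))]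
        refine hK' _ ⟨_, hqP _, _, hφ _ (hqP v), rfl⟩ ?_
        calc ‖q (φ v) - φ (q v)‖ = ‖φ' (v - q v) - (φ v - q (φ v))‖ := by
              congr 1
              simp only [φ', LinearMap.coe_toContinuousLinearMap', map_sub]
              abel
          _ ≤ ‖φ' (v - q v)‖ + ‖φ v - q (φ v)‖ := norm_sub_le _ _
          _ ≤ ‖φ'‖ * R + R := by
              gcongr
              · exact (φ'.le_opNorm _).trans (by gcongr; exact hqR _)
              · exact hqR _
          _ = R + ‖φ'‖ * R := add_comm _ _
      have h2 : ‖D' (ψ (q v) - g v)‖ ≤ ‖D'‖ * K :=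
        (D'.le_opNorm _).trans (by gcongr; exact hfg v)
      calc ‖(g.comp φ - D.comp g) v‖ = ‖-(ψ (q (φ v)) - g (φ v)) +
              (ψ (q (φ v)) - D (ψ (q v))) + D' (ψ (q v) - g v)‖ := by
            congr 1
            simp only [D', LinearMap.coe_toContinuousLinearMap', map_sub, LinearMap.sub_apply,
              LinearMap.comp_apply]
            abel
        _ ≤ ‖-(ψ (q (φ v)) - g (φ v))‖ + ‖ψ (q (φ v)) - D (ψ (q v))‖ +
              ‖D' (ψ (q v) - g v)‖ := norm_add₃_le
        _ ≤ K + K' + ‖D'‖ * K := by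
            gcongr
            rw [norm_neg]
            exact hfg _
    intro v
    exact sub_eq_zero.1 (LinearMap.congr_fun hz v)
  obtain rfl := hg g hgφ
  refine ⟨K'' + K, fun c hc => ?_⟩
  have h1 : ‖ψ c - ψ (q c)‖ ≤ K'' := by
    rw [← hψ _ (hPG hc) _ (hqG c)]
    exact hK'' _ ⟨_, hc, _, hqP c, rfl⟩ (hqR c)
  have h2 : ‖ψ (q c)‖ ≤ K := by simpa using hfg c
  calc ‖ψ c‖ = ‖(ψ c - ψ (q c)) + ψ (q c)‖ := by rw [sub_add_cancel]
    _ ≤ K'' + K := (norm_add_le _ _).trans (add_le_add h1 h2)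

end Absorbed

/-! ### The internal space and its cut-and-project lattice -/

lemma _root_.LinearMap.apply_aeval_of_semiconj {R S T M N : Type*} [CommRing R] [CommRing S]
    [CommRing T] [Algebra R S] [Algebra R T] [AddCommGroup M] [AddCommGroup N] [Module R M]
    [Module T M] [Module R N] [Module S N] [IsScalarTower R S N] [IsScalarTower R T M]
    {f : Module.End T M} {g : Module.End S N} {h : M →ₗ[R] N} (hfg : ∀ x, h (f x) = g (h x))
    (p : R[X]) (x : M) : h (aeval f p x) = aeval g p (h x) := by
  have hpow : ∀ n : ℕ, h ((f ^ n) x) = (g ^ n) (h x) := by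
    intro n
    induction n with
    | zero => rfl
    | succ n ih => rw [pow_succ', pow_succ', Module.End.mul_apply, Module.End.mul_apply, hfg, ih]
  induction p using Polynomial.induction_on' with
  | add p q hp hq => simp only [map_add, LinearMap.add_apply, hp, hq]
  | monomial n a =>
    simp only [aeval_monomial, Module.End.mul_apply, Module.algebraMap_end_apply, map_smul, hpow]

/-- A functional `h` with `h ∘ φ = z h` is killed by the value at `z` of the characteristic
polynomial of `φ`, by Cayley–Hamilton. Values in an extension `K` of `ℝ` allow for nonreal `z`. -/
lemma _root_.LinearMap.eq_zero_of_eigenvalue_not_root {V K : Type*} [AddCommGroup V] [Module ℝ V]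
    [Module.Free ℝ V] [Module.Finite ℝ V] [Field K] [Algebra ℝ K] {φ : V →ₗ[ℝ] V} {z : K}
    {h : V →ₗ[ℝ] K} (hz : ∀ v, h (φ v) = z * h v) (hroot : aeval z φ.charpoly ≠ 0) : h = 0 := by
  ext v
  have h1 := LinearMap.apply_aeval_of_semiconj (f := φ) (g := Algebra.lmul ℝ K z) (h := h)
    (fun v => by simp [hz]) φ.charpoly v
  rw [LinearMap.aeval_self_charpoly, aeval_algHom_apply] at h1
  simpa [hroot] using h1

section Block

variable {R : Finset ℝ} {Z : Finset ℂ} {J : ℕ} (y : EuclideanSpace ℝ (BlockIndex R Z J))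

lemma blockMap_inl (r : R) (j : Fin J) :
    blockMap R Z J y (Sum.inl r, j) = r * y (Sum.inl r, j) := by
  simp [blockMap, blockMatrix, Matrix.toLpLin_apply, Matrix.mulVec, dotProduct,
    Fintype.sum_prod_type, Matrix.blockDiagonal_apply, Matrix.diagonal_apply]

lemma blockMap_inr_zero (z : Z) (j : Fin J) :
    blockMap R Z J y (Sum.inr (0, z), j) =
      (z : ℂ).re * y (Sum.inr (0, z), j) - (z : ℂ).im * y (Sum.inr (1, z), j) := by
  simp [blockMap, blockMatrix, Matrix.toLpLin_apply, Matrix.mulVec, dotProduct,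
    Fintype.sum_prod_type, Matrix.blockDiagonal_apply, sub_eq_add_neg]

lemma blockMap_inr_one (z : Z) (j : Fin J) :
    blockMap R Z J y (Sum.inr (1, z), j) =
      (z : ℂ).im * y (Sum.inr (0, z), j) + (z : ℂ).re * y (Sum.inr (1, z), j) := by
  simp [blockMap, blockMatrix, Matrix.toLpLin_apply, Matrix.mulVec, dotProduct,
    Fintype.sum_prod_type, Matrix.blockDiagonal_apply]

end Block

variable {d J : ℕ} {φ : E d →ₗ[ℝ] E d}

/-- The eigenvalues of `D` are not eigenvalues of `φ`, so a coordinate of an intertwiner (a pair of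
coordinates `x + i y` in the nonreal case) would be an eigenfunctional of `φ` for an eigenvalue
that `φ` does not have. -/
lemma intertwiner_eq_zero {g : E d →ₗ[ℝ] Internal φ J}
    (hg : ∀ v, g (φ v) = internalMap φ J (g v)) : g = 0 := by
  have hmonic : φ.charpoly ≠ 0 := φ.charpoly_monic.ne_zero
  have hre : ∀ (r : realRest φ) j v, g v (Sum.inl r, j) = 0 := by
    intro r j v
    let h : E d →ₗ[ℝ] ℝ :=
      { toFun := fun v => g v (Sum.inl r, j)
        map_add' := fun v w => by simp
        map_smul' := fun c v => by simp }
    have hroot : aeval (r : ℝ) φ.charpoly ≠ 0 := by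
      have := (Finset.mem_sdiff.1 r.2).2
      simpa [realEig, hmonic, IsRoot.def, coe_aeval_eq_eval] using this
    have hz : h = 0 := LinearMap.eq_zero_of_eigenvalue_not_root (z := (r : ℝ)) (fun v => by
      change g (φ v) _ = _
      rw [hg]
      exact blockMap_inl _ r j) hroot
    exact LinearMap.congr_fun hz v
  have him : ∀ (z : complexRest φ) j v, g v (Sum.inr (0, z), j) = 0 ∧
      g v (Sum.inr (1, z), j) = 0 := by
    intro z j v
    let h : E d →ₗ[ℝ] ℂ :=
      { toFun := fun v => ⟨g v (Sum.inr (0, z), j), g v (Sum.inr (1, z), j)⟩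
        map_add' := fun v w => by apply Complex.ext <;> simp
        map_smul' := fun c v => by apply Complex.ext <;> simp }
    have hroot : aeval (z : ℂ) φ.charpoly ≠ 0 := by
      obtain ⟨h1, h2⟩ := Finset.mem_sdiff.1 z.2
      have h3 := (Finset.mem_filter.1 h1).2
      have h4 : complexCharpoly φ ≠ 0 := (φ.charpoly_monic.map _).ne_zero
      intro h0
      refine h2 (Finset.mem_filter.2 ⟨?_, h3⟩)
      rw [Multiset.mem_toFinset, mem_roots h4, IsRoot.def, complexCharpoly, eval_map]
      exact h0
    have hz : h = 0 := LinearMap.eq_zero_of_eigenvalue_not_root (z := (z : ℂ)) (fun v => by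
      have h0 := blockMap_inr_zero (g v) z j
      have h1 := blockMap_inr_one (g v) z j
      apply Complex.ext
      · change g (φ v) _ = _
        rw [hg, Complex.mul_re]
        exact h0
      · change g (φ v) _ = _
        rw [hg, Complex.mul_im, add_comm]
        exact h1) hroot
    have hv := LinearMap.congr_fun hz v
    exact ⟨congrArg Complex.re hv, congrArg Complex.im hv⟩
  ext v ⟨k | ⟨k, z⟩, j⟩
  · exact hre k j v
  · fin_cases k
    · exact (him z j v).1
    · exact (him z j v).2

namespace NormalForm

variable {B : NormalForm φ J}

lemma exists_mem_Ltilde {x : E d} (hx : x ∈ B.L) : ∃ w, (x, w) ∈ B.Ltilde := by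
  obtain ⟨P, rfl⟩ := hx
  exact ⟨_, P, rfl⟩

lemma mem_L_of_mem_Ltilde {p : E d × Internal φ J} (hp : p ∈ B.Ltilde) : p.1 ∈ B.L := by
  obtain ⟨P, rfl⟩ := hp
  exact ⟨P, rfl⟩

lemma aeval_mem_Ltilde (s : ℤ[X]) {p : E d × Internal φ J} (hp : p ∈ B.Ltilde) :
    (aeval φ s p.1, aeval (internalMap φ J) s p.2) ∈ B.Ltilde := by
  obtain ⟨P, rfl⟩ := hp
  exact ⟨fun j => s * P j, by simp [map_sum]⟩

lemma map_mem_Ltilde {p : E d × Internal φ J} (hp : p ∈ B.Ltilde) :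
    (φ p.1, internalMap φ J p.2) ∈ B.Ltilde := by
  simpa using aeval_mem_Ltilde X hp

/-- A discrete subgroup of a real vector space is finitely generated, so multiplication by `φ` on
the lattice is integral over `ℤ`. -/
lemma exists_monic_aeval_eq_zero_on_L (hdisc : DiscreteTopology B.Ltilde) :
    ∃ m : ℤ[X], m.Monic ∧ ∀ x ∈ B.L, aeval φ m x = 0 := by
  let L := AddSubgroup.toIntSubmodule B.Ltilde
  have : DiscreteTopology L := hdisc
  let f : L →ₗ[ℤ] L := AddMonoidHom.toIntLinearMap
    { toFun := fun p => ⟨(φ p.1.1, internalMap φ J p.1.2), map_mem_Ltilde p.2⟩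
      map_zero' := by ext1; simp
      map_add' := fun p q => by ext1; simp }
  let h : L →ₗ[ℤ] E d := AddMonoidHom.toIntLinearMap
    { toFun := fun p => p.1.1
      map_zero' := rfl
      map_add' := fun p q => rfl }
  obtain ⟨m, hm, hm0⟩ := LinearMap.exists_monic_and_aeval_eq_zero ℤ f
  refine ⟨m, hm, fun x hx => ?_⟩
  obtain ⟨w, hw⟩ := exists_mem_Ltilde hx
  have := LinearMap.apply_aeval_of_semiconj (f := f) (g := φ) (h := h) (fun _ => rfl) m ⟨(x, w), hw⟩
  rw [hm0, LinearMap.zero_apply, map_zero] at this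
  exact this.symm

end NormalForm

/-- By Gauss's lemma a unimodular map that is integral over `ℤ` has its inverse in `ℤ[φ]`. -/
lemma IsUnimodular.exists_aeval_inverse (huni : IsUnimodular φ) {m : ℤ[X]} (hm : m.Monic)
    (hm0 : aeval φ m = 0) : ∃ s : ℤ[X], aeval φ (X * s) = 1 := by
  have hdvd : minpoly ℚ φ ∣ m.map (algebraMap ℤ ℚ) :=
    minpoly.dvd ℚ φ (by rw [aeval_map_algebraMap, hm0])
  have hint : IsIntegral ℚ φ :=
    ⟨m.map (algebraMap ℤ ℚ), hm.map _, by
      rw [← aeval_def, aeval_map_algebraMap, hm0]⟩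
  obtain ⟨p, hp⟩ := IsIntegrallyClosed.eq_map_mul_C_of_dvd ℚ hm hdvd
  rw [(minpoly.monic hint).leadingCoeff, map_one, mul_one] at hp
  have hp0 : aeval φ p = 0 := by
    rw [← aeval_map_algebraMap ℚ, hp, minpoly.aeval]
  have hcoeff : p.coeff 0 = 1 ∨ p.coeff 0 = -1 := by
    unfold IsUnimodular at huni
    rw [← hp, coeff_map, eq_intCast] at huni
    rcases huni with h | h
    · left; exact_mod_cast h
    · right; exact_mod_cast h
  have hX : aeval φ (X * p.divX) + aeval φ (C (p.coeff 0)) = 0 := by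
    rw [← map_add, X_mul, divX_mul_X_add, hp0]
  rcases hcoeff with h | h
  · refine ⟨-p.divX, ?_⟩
    rw [h, map_one, map_one] at hX
    rw [mul_neg, map_neg, neg_eq_iff_add_eq_zero, hX]
  · refine ⟨p.divX, ?_⟩
    rwa [h, map_neg, map_neg, map_one, map_one, ← sub_eq_add_neg, sub_eq_zero] at hX

/-- A discrete subgroup meets bounded sets in finite sets. -/
lemma finite_bounded_of_discrete {V : Type*} [NormedAddCommGroup V] [ProperSpace V]
    (L : AddSubgroup V) [DiscreteTopology L] (R : ℝ) :
    ((L : Set V) ∩ Metric.closedBall 0 R).Finite := by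
  rw [Set.inter_comm]
  exact Metric.finite_isBounded_inter_isClosed DiscreteTopology.isDiscrete
    Metric.isBounded_closedBall AddSubgroup.isClosed_of_discrete

/-! ### Open windows -/

lemma pow_apply_aeval_pow {d : ℕ} {φ : E d →ₗ[ℝ] E d} {s : ℤ[X]} (hs : aeval φ (X * s) = 1)
    (M : ℕ) (x : E d) : (φ ^ M) (aeval φ (s ^ M) x) = x := by
  have h : φ ^ M * aeval φ (s ^ M) = 1 := by
    rw [← aeval_X_pow (R := ℤ) φ, ← map_mul, ← mul_pow, map_pow, hs, one_pow]
  rw [← Module.End.mul_apply, h, Module.End.one_apply]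

end SubstTiling

open SubstTiling in
theorem mainTheorem4 {d κ J N : ℕ} (hd : 0 < d)
    -- a primitive substitution tiling
    (ω : TileSubstitution d κ) (hprim : ω.IsPrimitive)
    (𝒯 : Set (Tile d κ)) (h𝒯 : ω.IsFixedTiling 𝒯)
    -- its control points
    (γ : Tile d κ → Tile d κ) (hγ : ω.IsTileMap γ)
    (C : Fin κ → Set (E d)) (hC : C = ω.controlPoints γ 𝒯)
    (hΞ : AddSubgroup.closure (⋃ i, C i) = AddSubgroup.closure (returnVectors C))
    -- the expansion map
    (hdiag : IsDiagonalizable ω.φ) (huni : IsUnimodular ω.φ)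
    (hconj : ConjugateEigenvalues ω.φ J)
    (B : NormalForm ω.φ J)
    -- rigidity
    (σ : E d ≃ₗ[ℝ] E d) (hσ : IsRigidVia B C σ)
    (hL : (AddSubgroup.closure (σ '' ⋃ i, C i) : Set (E d)) = B.L)
    -- existence of the cut-and-project scheme
    (hcps : IsCutAndProject B.Ltilde)
    -- generation from the origin, and the coincidence at the origin
    (hN : 0 < N) (j : Fin κ) (h0 : (0 : E d) ∈ C j)
    (hlim : IsLimit (fun n => ((ω.Phi γ)^[N])^[n] (originAt d j)) C)
    (hcoin : ∀ v ∈ returnVectors C, (ω.φ ^ N) v ∈ C j) :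
    ∀ i, ∃ U : Set (Internal ω.φ J),
      IsOpen U ∧ IsModelSetWithWindow B.Ltilde (σ '' C i) U := by
  set A := ω.φ ^ N with hAdef
  have hdisc : DiscreteTopology B.Ltilde := hcps.discrete
  set P : Set (E d) := ⋃ i, C i with hPdef
  let G : AddSubgroup (E d) := AddSubgroup.closure P
  have hPG : P ⊆ G := AddSubgroup.subset_closure
  -- the control points are relatively dense and locally finite
  obtain ⟨R, hR⟩ : ∃ R : ℝ, ∀ v, ∃ c ∈ P, ‖v - c‖ ≤ R := by
    rw [hPdef, hC]
    exact TileSubstitution.controlPoints_relativelyDense hγ h𝒯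
  have hφP : ∀ c ∈ P, ω.φ c ∈ P := by
    rw [hPdef, hC]
    exact fun c => TileSubstitution.map_mem_controlPoints hγ h𝒯
  have hX : ∀ R : ℝ, (C j ∩ Metric.closedBall 0 R).Finite := by
    rw [hC]
    exact TileSubstitution.controlPoints_locallyFinite hγ h𝒯 j
  have hinj : Function.Injective A := ω.expansive.pow_injective N
  -- differences of control points of equal type are absorbed by `C j`
  have hret : ∀ i, ∀ x ∈ C i, ∀ y ∈ C i, A (x - y) ∈ C j := fun i x hx y hy =>
    hcoin _ (Set.mem_iUnion.2 ⟨i, x, hx, y, hy, rfl⟩)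
  have hA := hret j
  have habs1 : ∀ x ∈ G, Absorbed A (C j) {x} := by
    intro x hx
    refine absorbed_singleton_of_mem_closure (S := returnVectors C) h0 hA (fun v hv => ⟨1, ?_⟩)
      (hΞ ▸ hx)
    rintro _ rfl
    simpa using hcoin _ hv
  have habsP : Absorbed A (C j) P := by
    refine absorbed_iUnion h0 hA fun i => ?_
    rcases (C i).eq_empty_or_nonempty with he | ⟨c, hc⟩
    · exact ⟨0, by simp [he]⟩
    · have h1 : Absorbed A (C j) {v | ∃ x ∈ C i, v = x - c} := by
        refine ⟨1, ?_⟩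
        rintro _ ⟨x, hx, rfl⟩
        simpa using hret i x hx c hc
      refine (h1.add h0 hA (habs1 c (hPG (Set.mem_iUnion.2 ⟨i, hc⟩)))).mono fun x hx => ?_
      exact ⟨x - c, ⟨x, hx, rfl⟩, c, rfl, by abel⟩
  -- `σ` identifies `G` with `L`
  have hσG : ∀ x, x ∈ G ↔ σ x ∈ B.L := by
    intro x
    have h1 : AddSubgroup.closure (σ '' P) = G.map (σ : E d →+ E d) :=
      (AddMonoidHom.map_closure (σ : E d →+ E d) P).symm
    rw [← hL, h1, SetLike.mem_coe]
    constructor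
    · exact fun h => ⟨x, h, rfl⟩
    · rintro ⟨y, hy, hyx⟩
      rwa [← σ.injective hyx]
  -- `ψ` is the star map `Ψ ∘ σ` on `G`
  choose! ψ hψ using fun x (hx : x ∈ G) => NormalForm.exists_mem_Ltilde ((hσG x).1 hx)
  have hψu : ∀ x ∈ G, ∀ w, (σ x, w) ∈ B.Ltilde → w = ψ x := fun x hx w hw =>
    congrArg Prod.snd (hcps.injOn_fst hw (hψ x hx) rfl)
  have hψsub : ∀ x ∈ G, ∀ y ∈ G, ψ (x - y) = ψ x - ψ y := fun x hx y hy =>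
    (hψu _ (G.sub_mem hx hy) _ (by
      rw [map_sub]
      exact B.Ltilde.sub_mem (hψ x hx) (hψ y hy))).symm
  set D := internalMap ω.φ J with hDdef
  have hσaeval : ∀ (s : ℤ[X]) x, σ (aeval ω.φ s x) = aeval ω.φ s (σ x) := fun s x =>
    LinearMap.apply_aeval_of_semiconj (f := ω.φ) (g := ω.φ)
      (h := (σ : E d →ₗ[ℝ] E d).restrictScalars ℤ) hσ.comm s x
  have hGaeval : ∀ (s : ℤ[X]), ∀ x ∈ G,
      aeval ω.φ s x ∈ G ∧ ψ (aeval ω.φ s x) = aeval D s (ψ x) := by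
    intro s x hx
    have h1 := NormalForm.aeval_mem_Ltilde s (hψ x hx)
    rw [← hσaeval] at h1
    have h2 := (hσG _).2 (NormalForm.mem_L_of_mem_Ltilde h1)
    exact ⟨h2, (hψu _ h2 _ h1).symm⟩
  have hψφ : ∀ x ∈ G, ψ (ω.φ x) = D (ψ x) := fun x hx => by
    simpa using (hGaeval X x hx).2
  -- the star map is bounded on the control points
  obtain ⟨K, hK⟩ := exists_norm_le_of_no_intertwiner h0 hA hinj hX habsP hR hφP hPG hψsub hψφ
    fun g hg => intertwiner_eq_zero hg
  -- elements of `G` with bounded image under the star map are absorbed by `C j`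
  have hball : Absorbed A (C j) {y | y ∈ G ∧ ‖ψ y‖ ≤ 1} := by
    let F : Set (E d) := {f | f ∈ G ∧ ‖f‖ ≤ R ∧ ‖ψ f‖ ≤ 1 + K}
    have hF : F.Finite := by
      let σ' := LinearMap.toContinuousLinearMap (σ : E d →ₗ[ℝ] E d)
      have hfin := finite_bounded_of_discrete B.Ltilde (max (‖σ'‖ * R) (1 + K))
      refine Set.Finite.of_finite_image (f := fun f => (σ f, ψ f)) (hfin.subset ?_) ?_
      · rintro _ ⟨f, ⟨hf, hfR, hfK⟩, rfl⟩
        refine ⟨hψ f hf, ?_⟩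
        rw [mem_closedBall_zero_iff]
        exact max_le_max ((σ'.le_opNorm f).trans (by gcongr)) hfK
      · intro f _ f' _ h
        exact σ.injective (congrArg Prod.fst h)
    have hFabs := absorbed_of_finite h0 hA hF fun x hx => habs1 x hx.1
    refine (hFabs.add h0 hA habsP).mono ?_
    rintro y ⟨hy, hy1⟩
    obtain ⟨c, hc, hyc⟩ := hR y
    refine ⟨y - c, ⟨G.sub_mem hy (hPG hc), hyc, ?_⟩, c, hc, by abel⟩
    rw [hψsub y hy c (hPG hc)]
    exact (norm_sub_le _ _).trans (add_le_add hy1 (hK c hc))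
  obtain ⟨k, hk⟩ := hball
  -- `φ` is invertible in `ℤ[φ]`
  obtain ⟨s, hs⟩ : ∃ s : ℤ[X], aeval ω.φ (X * s) = 1 := by
    obtain ⟨m, hm, hm0⟩ := NormalForm.exists_monic_aeval_eq_zero_on_L hdisc
    refine huni.exists_aeval_inverse hm ?_
    -- `m(φ)` vanishes on the relatively dense set `P`
    let f := LinearMap.toContinuousLinearMap (aeval ω.φ m)
    refine LinearMap.eq_zero_of_norm_le _ (K := ‖f‖ * R) fun v => ?_
    obtain ⟨c, hc, hvc⟩ := hR v
    have hfc : aeval ω.φ m c = 0 := σ.injective (by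
      rw [hσaeval, hm0 _ ((hσG c).1 (hPG hc)), map_zero])
    calc ‖aeval ω.φ m v‖ = ‖f (v - c)‖ := by
          simp only [f, LinearMap.coe_toContinuousLinearMap', map_sub, hfc, sub_zero]
      _ ≤ ‖f‖ * R := (f.le_opNorm _).trans (by gcongr)
  -- each control point has an open neighbourhood in the internal space
  have hnhd : ∀ i, ∀ x ∈ C i, ∃ V : Set (Internal ω.φ J), IsOpen V ∧ ψ x ∈ V ∧
      ∀ z ∈ G, ψ z ∈ V → z ∈ C i := by
    intro i x hx
    obtain ⟨n, hn⟩ := (hlim i x).exists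
    have hxn : x ∈ (ω.Phi γ)^[N * n] (originAt d j) i := by
      rw [Function.iterate_mul]
      exact hn.2 hx
    let T : Internal ω.φ J →ₗ[ℝ] Internal ω.φ J := aeval D (s ^ (N * n + N * k))
    have hxG : x ∈ G := hPG (Set.mem_iUnion.2 ⟨i, hx⟩)
    refine ⟨{w | ‖T (w - ψ x)‖ < 1}, ?_, by simp, fun z hz hzV => ?_⟩
    · have hT : Continuous T := LinearMap.continuous_of_finiteDimensional T
      exact isOpen_lt (by fun_prop) continuous_const
    · obtain ⟨hyG, hy⟩ := hGaeval (s ^ (N * n + N * k)) _ (G.sub_mem hz hxG)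
      set y := aeval ω.φ (s ^ (N * n + N * k)) (z - x) with hydef
      rw [hψsub z hz x hxG] at hy
      have hyC : (A ^ k) y ∈ C j := hk y ⟨hyG, by rw [hy]; exact hzV.le⟩
      have hzx : (ω.φ ^ (N * n)) ((A ^ k) y) = z - x := by
        rw [hAdef, ← pow_mul, ← Module.End.mul_apply, ← pow_add, hydef,
          pow_apply_aeval_pow hs]
      rw [hC] at hyC ⊢
      have := TileSubstitution.Phi_iterate_subset hγ h𝒯 j (N * n) i x hxn _ hyC
      rwa [hzx, sub_add_cancel] at this
  intro i
  choose! V hVo hxV hV using hnhd i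
  let U : Set (Internal ω.φ J) := (⋃ x ∈ C i, V x) ∩ Metric.ball 0 (K + 1)
  have hUo : IsOpen U := (isOpen_biUnion hVo).inter Metric.isOpen_ball
  have hmemU : ∀ x ∈ C i, ψ x ∈ U := fun x hx => by
    refine ⟨Set.mem_iUnion₂.2 ⟨x, hx, hxV x hx⟩, ?_⟩
    rw [mem_ball_zero_iff]
    exact (hK x (Set.mem_iUnion.2 ⟨i, hx⟩)).trans_lt (lt_add_one K)
  refine ⟨U, hUo, ?_, ?_, ?_⟩
  · obtain ⟨l, -, hl⟩ := hprim
    obtain ⟨c, hc⟩ : (C i).Nonempty := by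
      rw [hC] at h0 ⊢
      exact TileSubstitution.controlPoints_nonempty_of_matrix_pow hγ h𝒯 ⟨0, h0⟩ l i (hl i j)
    rw [hUo.interior_eq]
    exact ⟨_, hmemU c hc⟩
  · exact (Metric.isBounded_ball.subset Set.inter_subset_right).isCompact_closure
  · ext y
    constructor
    · rintro ⟨x, hx, rfl⟩
      exact ⟨(σ x, ψ x), hψ x (hPG (Set.mem_iUnion.2 ⟨i, hx⟩)), hmemU x hx, rfl⟩
    · rintro ⟨p, hp, hpU, rfl⟩
      obtain ⟨z, hz⟩ := σ.surjective p.1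
      have hzG : z ∈ G := (hσG z).2 (hz ▸ NormalForm.mem_L_of_mem_Ltilde hp)
      have hpz : p.2 = ψ z := hψu z hzG _ (by rw [hz]; exact hp)
      obtain ⟨x, hx, hzx⟩ := Set.mem_iUnion₂.1 hpU.1
      exact ⟨z, hV x hx z hzG (hpz ▸ hzx), hz⟩
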